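/- Let $H$ and $K$ be complex Hilbert spaces of arbitrary dimensions and let $T\colon H\to K$ be a bounded linear operator. Put $|T|=\sqrt{T^*T}$. Then there is a unique partial isometry $U\colon H\to K$ with initial space $\overline{\operatorname{ran}|T|}$ and final space $\overline{\operatorname{ran}T}$ such that $T=U|T|$, and it satisfies $U^*T=|T|$. Call $T$ absolutely norming ($\mathcal{AN}$) if for every nonzero closed subspace $M\subseteq H$ (including $M=H$) there is a unit vector $x\in M$ with $\|T|_M\|=\|Tx\|$. Then $T$ is $\mathcal{AN}$ if and only if $$U^*T=\alpha I+F+C$$ for some real number $\alpha\ge 0$, some self-adjoint finite-rank operator $F$ on $H$ and some positive compact operator $C$ on $H$. -/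

import Mathlib

section NormingOperators

variable {H K : Type*} [NormedAddCommGroup H] [InnerProductSpace ℂ H]
  [NormedAddCommGroup K] [InnerProductSpace ℂ K]

/-- `T` is norming: it attains its operator norm on the unit sphere. -/
def IsNorming (T : H →L[ℂ] K) : Prop :=
  ∃ x : H, ‖x‖ = 1 ∧ ‖T‖ = ‖T x‖

/-- `T` is absolutely norming: its restriction to every nonzero closed subspace
(the whole space included) is norming. -/
def IsAbsolutelyNorming (T : H →L[ℂ] K) : Prop :=
  ∀ M : Submodule ℂ H, IsClosed (M : Set H) → M ≠ ⊥ → IsNorming (T ∘L M.subtypeL)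

/-- The initial space of a partial isometry: the orthogonal complement of its kernel. -/
noncomputable def initialSpace (U : H →L[ℂ] K) : Submodule ℂ H :=
  (LinearMap.ker (U : H →ₗ[ℂ] K))ᗮ

/-- The final space of a partial isometry: its range. -/
def finalSpace (U : H →L[ℂ] K) : Submodule ℂ K :=
  LinearMap.range (U : H →ₗ[ℂ] K)

/-- `U` is a partial isometry: it is isometric on the orthogonal complement of its kernel. -/
def IsPartialIsometry (U : H →L[ℂ] K) : Prop :=
  ∀ x ∈ initialSpace U, ‖U x‖ = ‖x‖

/-- `F` has finite rank. -/
def IsFiniteRank (F : H →L[ℂ] K) : Prop :=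
  FiniteDimensional ℂ (LinearMap.range (F : H →ₗ[ℂ] K))

end NormingOperators

section Polar

variable {H K : Type*} [NormedAddCommGroup H] [InnerProductSpace ℂ H] [CompleteSpace H]
  [NormedAddCommGroup K] [InnerProductSpace ℂ K] [CompleteSpace K]

/-- The absolute value `|T| = √(T* T)` of an operator between two Hilbert spaces. -/
noncomputable def absOp (T : H →L[ℂ] K) : H →L[ℂ] H :=
  CFC.sqrt (ContinuousLinearMap.adjoint T ∘L T)

/-- `U` is the partial isometry of the polar decomposition `T = U |T|`. -/
structure IsPolarFactor (T U : H →L[ℂ] K) : Prop where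
  partialIsometry : IsPartialIsometry U
  initial : initialSpace U = (LinearMap.range (absOp T : H →ₗ[ℂ] H)).topologicalClosure
  final : finalSpace U = (LinearMap.range (T : H →ₗ[ℂ] K)).topologicalClosure
  eq_comp : T = U ∘L absOp T

end Polar

/-! Since `‖|T|x‖ = ‖Tx‖`, the map `|T|x ↦ Tx` extends to an isometry between the closures of the
ranges, which gives `U`. Moreover `U†T = |T|`, and `|T|` is absolutely norming exactly when `T` is.

Sufficiency: squaring `α + F + C` shows that `T†T` has the same shape, a shape that survives
compression to any closed subspace and forces the norm to be attained
(`isNorming_of_adjoint_comp_eq`).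

Necessity, for `P = |T|`: norm attainment on invariant subspaces yields an orthonormal eigenbasis
(`exists_eigenbasis`). Every nonempty subfamily of eigenvalues has a maximum
(`exists_forall_norm_le`), and two infinite subfamilies cannot be separated by a gap
(`not_infinite_and_infinite`). Hence, counted with multiplicity, the eigenvalues accumulate at most
at one `α`, and only from above: the finitely many below `α` give `F`, the others give `C`. -/

open ContinuousLinearMap

/-! ### The absolute value and vectors of maximal stretch. -/

section AbsoluteValue

variable {H K : Type*} [NormedAddCommGroup H] [InnerProductSpace ℂ H] [CompleteSpace H]
  [NormedAddCommGroup K] [InnerProductSpace ℂ K] [CompleteSpace K]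

theorem absOp_isPositive (T : H →L[ℂ] K) : (absOp T).IsPositive :=
  (nonneg_iff_isPositive _).1 (CFC.sqrt_nonneg _)

theorem absOp_comp_absOp (T : H →L[ℂ] K) : absOp T ∘L absOp T = adjoint T ∘L T :=
  CFC.sqrt_mul_sqrt_self (adjoint T ∘L T)
    ((nonneg_iff_isPositive _).2 (isPositive_adjoint_comp_self T))

theorem adjoint_absOp (T : H →L[ℂ] K) : adjoint (absOp T) = absOp T :=
  (absOp_isPositive T).isSelfAdjoint.adjoint_eq

theorem norm_eq_norm_of_adjoint_comp_eq {E F G : Type*}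
    [NormedAddCommGroup E] [InnerProductSpace ℂ E] [CompleteSpace E]
    [NormedAddCommGroup F] [InnerProductSpace ℂ F] [CompleteSpace F]
    [NormedAddCommGroup G] [InnerProductSpace ℂ G] [CompleteSpace G]
    {A : E →L[ℂ] F} {B : E →L[ℂ] G} (h : adjoint A ∘L A = adjoint B ∘L B) (x : E) :
    ‖A x‖ = ‖B x‖ := by
  rw [← sq_eq_sq₀ (norm_nonneg _) (norm_nonneg _), apply_norm_sq_eq_inner_adjoint_left,
    apply_norm_sq_eq_inner_adjoint_left, h]

theorem norm_absOp_apply (T : H →L[ℂ] K) (x : H) : ‖absOp T x‖ = ‖T x‖ :=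
  norm_eq_norm_of_adjoint_comp_eq (by rw [adjoint_absOp, absOp_comp_absOp]) x

/-- If a vector is stretched by the largest factor `c` allowed by a bound for `B`, then it is an
eigenvector of `B† B` for `c ^ 2`. -/
theorem adjoint_apply_apply_of_norm_eq {E F : Type*}
    [NormedAddCommGroup E] [InnerProductSpace ℂ E] [CompleteSpace E]
    [NormedAddCommGroup F] [InnerProductSpace ℂ F] [CompleteSpace F]
    (B : E →L[ℂ] F) {c : ℝ} (hB : ‖B‖ ≤ c) {u : E} (hu : ‖B u‖ = c * ‖u‖) :
    adjoint B (B u) = ((c ^ 2 : ℝ) : ℂ) • u := by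
  have hc : 0 ≤ c := (norm_nonneg _).trans hB
  have h1 : ‖adjoint B (B u)‖ ≤ c * (c * ‖u‖) := by
    rw [← hu]
    refine (le_opNorm _ _).trans ?_
    rw [LinearIsometryEquiv.norm_map]
    gcongr
  have h2 : RCLike.re (inner ℂ (adjoint B (B u)) (((c ^ 2 : ℝ) : ℂ) • u)) =
      c ^ 2 * (c * ‖u‖) ^ 2 := by
    rw [inner_smul_right, adjoint_inner_left, inner_self_eq_norm_sq_to_K, hu]
    norm_cast
    exact Complex.re_ofReal_mul _ _
  -- Expanding the square, the two square terms are each at most `c⁴‖u‖²` and the cross term is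
  -- exactly `-2c⁴‖u‖²`.
  have h3 := norm_sub_sq (𝕜 := ℂ) (adjoint B (B u)) (((c ^ 2 : ℝ) : ℂ) • u)
  rw [h2, norm_smul, Complex.norm_of_nonneg (by positivity)] at h3
  have h4 : ‖adjoint B (B u)‖ ^ 2 ≤ (c * (c * ‖u‖)) ^ 2 := by gcongr
  have h5 : ‖adjoint B (B u) - ((c ^ 2 : ℝ) : ℂ) • u‖ ^ 2 ≤ 0 := by
    rw [h3]; linarith [h4]
  rw [← sub_eq_zero, ← norm_eq_zero]
  exact pow_eq_zero_iff two_ne_zero |>.1 (le_antisymm h5 (by positivity))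

end AbsoluteValue

/-! ### Existence and uniqueness of the polar factor. -/

section PolarDecomposition

variable {H K : Type*} [NormedAddCommGroup H] [InnerProductSpace ℂ H] [CompleteSpace H]
  [NormedAddCommGroup K] [InnerProductSpace ℂ K] [CompleteSpace K]

theorem orthogonal_initialSpace {K : Type*} [NormedAddCommGroup K] [InnerProductSpace ℂ K]
    (U : H →L[ℂ] K) :
    (initialSpace U)ᗮ = LinearMap.ker (U : H →ₗ[ℂ] K) := by
  have : IsClosed (LinearMap.ker (U : H →ₗ[ℂ] K) : Set H) := U.isClosed_ker
  have := this.completeSpace_coe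
  exact Submodule.orthogonal_orthogonal _

theorem IsPartialIsometry.norm_le_one {K : Type*} [NormedAddCommGroup K] [InnerProductSpace ℂ K]
    {U : H →L[ℂ] K} (hU : IsPartialIsometry U) : ‖U‖ ≤ 1 := by
  refine opNorm_le_bound _ zero_le_one fun x ↦ ?_
  have hc : CompleteSpace (initialSpace U) :=
    (Submodule.isClosed_orthogonal _).completeSpace_coe
  obtain ⟨y, hy, z, hz, rfl⟩ := (initialSpace U).exists_add_mem_mem_orthogonal x
  have hUz : U z = 0 := by
    rw [orthogonal_initialSpace] at hz
    exact hz
  rw [map_add, hUz, add_zero, hU y hy, one_mul]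
  have := norm_add_sq_eq_norm_sq_add_norm_sq_of_inner_eq_zero y z
    (by rw [(Submodule.mem_orthogonal _ _).1 hz y hy])
  exact le_of_sq_le_sq (by nlinarith [mul_self_nonneg ‖z‖]) (norm_nonneg _)

/-- `U` is a contraction that preserves the norm of `|T|x`, so the extremal case `c = 1` gives
`U†U|T|x = |T|x`. -/
theorem IsPolarFactor.adjoint_comp {T U : H →L[ℂ] K} (h : IsPolarFactor T U) :
    adjoint U ∘L T = absOp T := by
  ext x
  have hx : absOp T x ∈ initialSpace U := by
    rw [h.initial]
    exact Submodule.le_topologicalClosure _ ⟨x, rfl⟩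
  have hT : T x = U (absOp T x) := congrArg (· x) h.eq_comp
  rw [comp_apply, hT, adjoint_apply_apply_of_norm_eq U h.partialIsometry.norm_le_one (by
    rw [h.partialIsometry _ hx, one_mul])]
  simp

theorem IsPolarFactor.unique {T U V : H →L[ℂ] K} (hU : IsPolarFactor T U)
    (hV : IsPolarFactor T V) : U = V := by
  ext x
  have hc : CompleteSpace (initialSpace U) :=
    (Submodule.isClosed_orthogonal _).completeSpace_coe
  obtain ⟨y, hy, z, hz, rfl⟩ := (initialSpace U).exists_add_mem_mem_orthogonal x
  have hUz : U z = 0 := by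
    rw [orthogonal_initialSpace] at hz
    exact hz
  have hVz : V z = 0 := by
    rw [hU.initial, ← hV.initial, orthogonal_initialSpace] at hz
    exact hz
  have hle : (LinearMap.range (absOp T : H →ₗ[ℂ] H)).topologicalClosure ≤
      LinearMap.ker (U - V : H →L[ℂ] K).toLinearMap := by
    refine Submodule.topologicalClosure_minimal _ ?_ (U - V).isClosed_ker
    rintro _ ⟨w, rfl⟩
    have h1 : T w = U (absOp T w) := congrArg (· w) hU.eq_comp
    have h2 : T w = V (absOp T w) := congrArg (· w) hV.eq_comp
    simp [← h1, ← h2]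
  have hy' : U y - V y = 0 := hle (hU.initial ▸ hy)
  rw [map_add, map_add, hUz, hVz, sub_eq_zero.1 hy']

theorem exists_isPolarFactor (T : H →L[ℂ] K) : ∃ U : H →L[ℂ] K, IsPolarFactor T U := by
  set R : Submodule ℂ H := (LinearMap.range (absOp T : H →ₗ[ℂ] H)).topologicalClosure with hR
  have hRc : CompleteSpace R := (Submodule.isClosed_topologicalClosure _).completeSpace_coe
  let e : H →ₗ[ℂ] R := (absOp T : H →ₗ[ℂ] H).codRestrict R fun x ↦
    Submodule.le_topologicalClosure _ ⟨x, rfl⟩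
  have he : ∀ x, (e x : H) = absOp T x := fun _ ↦ rfl
  have hed : DenseRange e := by
    intro y
    rw [closure_subtype]
    have : (Subtype.val '' Set.range e : Set H) = Set.range (absOp T) := by
      rw [← Set.range_comp]; rfl
    rw [this]
    exact y.2
  have hen : ∀ x, ‖T x‖ = ‖e x‖ := fun x ↦ (norm_absOp_apply T x).symm
  let V : R →L[ℂ] K := (T : H →ₗ[ℂ] K).extendOfNorm e
  have hV : ∀ x, V (e x) = T x :=
    LinearMap.extendOfNorm_eq hed ⟨1, fun x ↦ by rw [one_mul]; exact (hen x).le⟩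
  have hVn : ∀ y, ‖V y‖ = ‖y‖ := fun y ↦
    hed.induction_on (p := fun y ↦ ‖V y‖ = ‖y‖) y
      (isClosed_eq (by fun_prop) (by fun_prop)) fun x ↦ by rw [hV, hen]
  let U : H →L[ℂ] K := V ∘L R.orthogonalProjectionOnto
  have hUR : ∀ y : R, U y = V y := fun y ↦ by simp [U]
  have hker : LinearMap.ker (U : H →ₗ[ℂ] K) = Rᗮ := by
    ext x
    rw [LinearMap.mem_ker, ← Submodule.ker_orthogonalProjectionOnto (K := R)]
    change V (R.orthogonalProjectionOnto x) = 0 ↔ R.orthogonalProjectionOnto x = 0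
    rw [← norm_eq_zero, hVn, norm_eq_zero]
  have hinit : initialSpace U = R := by
    rw [initialSpace, hker, Submodule.orthogonal_orthogonal]
  refine ⟨U, ?_, hinit, ?_, ?_⟩
  · intro x hx
    rw [hinit] at hx
    exact (congrArg norm (hUR ⟨x, hx⟩)).trans (hVn _)
  · have hrange : (finalSpace U : Set K) = Set.range V := by
      ext k
      constructor
      · rintro ⟨x, rfl⟩
        exact ⟨_, rfl⟩
      · rintro ⟨y, rfl⟩
        exact ⟨y, hUR y⟩
    have hiso : Isometry V := AddMonoidHomClass.isometry_of_norm V hVn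
    have hcl : IsClosed (finalSpace U : Set K) := by
      rw [hrange]
      exact hiso.isClosedEmbedding.isClosed_range
    apply le_antisymm
    · intro k hk
      have hk' : k ∈ Set.range V := hrange ▸ hk
      obtain ⟨y, rfl⟩ := hk'
      refine hed.induction_on
        (p := fun y ↦ V y ∈ (LinearMap.range (T : H →ₗ[ℂ] K)).topologicalClosure)
        y ((Submodule.isClosed_topologicalClosure _).preimage V.continuous) fun x ↦ ?_
      rw [hV]
      exact Submodule.le_topologicalClosure _ ⟨x, rfl⟩
    · refine Submodule.topologicalClosure_minimal _ ?_ hcl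
      rintro _ ⟨x, rfl⟩
      exact ⟨e x, (hUR _).trans (hV x)⟩
  · ext x
    exact ((hUR (e x)).trans (hV x)).symm

end PolarDecomposition

/-! ### Finite-rank operators. -/

section FiniteRank

variable {E F G : Type*} [NormedAddCommGroup E] [InnerProductSpace ℂ E]
  [NormedAddCommGroup F] [InnerProductSpace ℂ F] [NormedAddCommGroup G] [InnerProductSpace ℂ G]

theorem IsFiniteRank.add {A B : E →L[ℂ] F} (hA : IsFiniteRank A) (hB : IsFiniteRank B) :
    IsFiniteRank (A + B) := by
  unfold IsFiniteRank at *
  refine Submodule.finiteDimensional_of_le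
    (S₂ := LinearMap.range (A : E →ₗ[ℂ] F) ⊔ LinearMap.range (B : E →ₗ[ℂ] F)) ?_
  rintro _ ⟨x, rfl⟩
  exact Submodule.add_mem_sup ⟨x, rfl⟩ ⟨x, rfl⟩

theorem IsFiniteRank.comp_left {A : E →L[ℂ] F} (hA : IsFiniteRank A) (B : F →L[ℂ] G) :
    IsFiniteRank (B ∘L A) := by
  unfold IsFiniteRank at *
  rw [toLinearMap_comp, LinearMap.range_comp]
  infer_instance

theorem IsFiniteRank.comp_right {A : F →L[ℂ] G} (hA : IsFiniteRank A) (B : E →L[ℂ] F) :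
    IsFiniteRank (A ∘L B) := by
  unfold IsFiniteRank at *
  refine Submodule.finiteDimensional_of_le (S₂ := LinearMap.range (A : F →ₗ[ℂ] G)) ?_
  rintro _ ⟨x, rfl⟩
  exact ⟨B x, rfl⟩

theorem IsFiniteRank.isCompactOperator {A : E →L[ℂ] F} (hA : IsFiniteRank A) :
    IsCompactOperator A := by
  unfold IsFiniteRank at hA
  have h : IsCompactOperator (id : LinearMap.range (A : E →ₗ[ℂ] F) → _) :=
    isCompactOperator_id_iff_finiteDimensional (𝕜 := ℂ).2 hA
  exact (h.clm_comp (LinearMap.range (A : E →ₗ[ℂ] F)).subtypeL).comp_clm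
    (A.codRestrict (LinearMap.range (A : E →ₗ[ℂ] F)) fun x ↦ ⟨x, rfl⟩)

end FiniteRank

/-! ### Sufficiency: norm attainment from the shape of `B†B`. -/

section Norming

variable {E F : Type*} [NormedAddCommGroup E] [InnerProductSpace ℂ E] [CompleteSpace E]
  [NormedAddCommGroup F] [InnerProductSpace ℂ F] [CompleteSpace F]

theorem norm_sq_eq_norm_adjoint_comp (B : E →L[ℂ] F) : ‖B‖ ^ 2 = ‖adjoint B ∘L B‖ := by
  rw [norm_adjoint_comp_self, sq]

theorem isNorming_of_le {B : E →L[ℂ] F} {x : E} (hx : x ≠ 0)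
    (h : ‖adjoint B ∘L B‖ * ‖x‖ ^ 2 ≤ RCLike.re (inner ℂ (adjoint B (B x)) x)) :
    IsNorming B := by
  have hx' : ‖x‖ ≠ 0 := norm_ne_zero_iff.2 hx
  have h1 : ‖B‖ * ‖x‖ ≤ ‖B x‖ := by
    rw [adjoint_inner_left, inner_self_eq_norm_sq, ← norm_sq_eq_norm_adjoint_comp] at h
    refine le_of_sq_le_sq ?_ (norm_nonneg _)
    linarith [mul_pow ‖B‖ ‖x‖ 2]
  have h2 : ‖B x‖ = ‖B‖ * ‖x‖ := le_antisymm (B.le_opNorm x) h1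
  refine ⟨((‖x‖⁻¹ : ℝ) : ℂ) • x, ?_, ?_⟩
  · rw [norm_smul, Complex.norm_of_nonneg (by positivity), inv_mul_cancel₀ hx']
  · rw [map_smul, norm_smul, Complex.norm_of_nonneg (by positivity), h2]
    field_simp

/-- The norm `N` of `B†B` lies in its spectrum. If `N ≠ β`, then `N - β` is a nonzero spectral value
of the compact operator `A + C`, hence an eigenvalue. If `N = β`, any nonzero vector of `ker A` has
Rayleigh quotient at least `β`; when `A` is injective, the space is finite-dimensional. -/
theorem isNorming_of_adjoint_comp_eq [Nontrivial E] {B : E →L[ℂ] F} {β : ℝ} {A C : E →L[ℂ] E}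
    (hA : IsFiniteRank A) (hC : C.IsPositive) (hC' : IsCompactOperator C)
    (h : adjoint B ∘L B = (β : ℂ) • ContinuousLinearMap.id ℂ E + A + C) : IsNorming B := by
  have key : ∀ G : E →L[ℂ] E, IsCompactOperator G → ∀ γ : ℝ,
      adjoint B ∘L B = (γ : ℂ) • ContinuousLinearMap.id ℂ E + G →
      ‖adjoint B ∘L B‖ ≠ γ → IsNorming B := by
    intro G hG γ hγ hne
    have hpos : (0 : E →L[ℂ] E) ≤ adjoint B ∘L B :=
      (nonneg_iff_isPositive _).2 (isPositive_adjoint_comp_self B)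
    have hmem := spectrum.algebraMap_mem ℂ (CStarAlgebra.norm_mem_spectrum_of_nonneg hpos)
    set N : ℝ := ‖adjoint B ∘L B‖ with hN
    have hmem' : ((N - γ : ℝ) : ℂ) ∈ spectrum ℂ G := by
      have hG' : adjoint B ∘L B = algebraMap ℂ (E →L[ℂ] E) (γ : ℂ) + G := by
        rw [hγ, Algebra.algebraMap_eq_smul_one]; rfl
      rw [hG'] at hmem
      refine spectrum.add_mem_add_iff (s := (γ : ℂ)).1 ?_
      rw [← Complex.ofReal_add, sub_add_cancel]
      exact hmem
    have hne' : ((N - γ : ℝ) : ℂ) ≠ 0 := by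
      exact_mod_cast sub_ne_zero.2 hne
    obtain ⟨x, hx⟩ := ((hG.hasEigenvalue_iff_mem_spectrum hne').2 hmem').exists_hasEigenvector
    have hGx : G x = ((N - γ : ℝ) : ℂ) • x := hx.apply_eq_smul
    refine isNorming_of_le hx.2 ?_
    have hBx : adjoint B (B x) = (N : ℂ) • x := by
      have := congrArg (· x) hγ
      simp only [comp_apply, add_apply, smul_apply, id_apply, hGx] at this
      rw [this, ← add_smul]
      push_cast
      ring_nf
    rw [hBx, inner_smul_left, inner_self_eq_norm_sq_to_K, Complex.conj_ofReal]
    apply le_of_eq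
    norm_cast
    exact (Complex.re_ofReal_mul N ((‖x‖ ^ 2 : ℝ) : ℂ)).symm
  by_cases hN : ‖adjoint B ∘L B‖ = β
  · by_cases hker : ∃ x, x ≠ 0 ∧ A x = 0
    · obtain ⟨x, hx, hAx⟩ := hker
      refine isNorming_of_le hx ?_
      have hBx : adjoint B (B x) = (β : ℂ) • x + C x := by
        have := congrArg (· x) h
        simpa [hAx] using this
      rw [hBx, inner_add_left, inner_smul_left, inner_self_eq_norm_sq_to_K, Complex.conj_ofReal,
        map_add, hN]
      have h1 := hC.re_inner_nonneg_left x
      have h2 : RCLike.re ((β : ℂ) * (‖x‖ : ℂ) ^ 2) = β * ‖x‖ ^ 2 := by norm_cast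
      exact h2 ▸ le_add_of_nonneg_right h1
    · push Not at hker
      have hinj : Function.Injective (A : E →ₗ[ℂ] E) := by
        rw [← LinearMap.ker_eq_bot, LinearMap.ker_eq_bot']
        intro x hx
        by_contra hx'
        exact hker x hx' hx
      unfold IsFiniteRank at hA
      have hfin : FiniteDimensional ℂ E :=
        (LinearEquiv.ofInjective _ hinj).symm.finiteDimensional
      have hid : IsFiniteRank (ContinuousLinearMap.id ℂ E) := by
        unfold IsFiniteRank; infer_instance
      -- In finite dimension every operator is compact, so any scalar may be split off; `-1` is
      -- never a norm.
      refine key _ ((hid.comp_left (adjoint B ∘L B + ContinuousLinearMap.id ℂ E)).isCompactOperator)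
        (-1) ?_ ?_
      · ext x
        simp
      · exact ((neg_lt_zero.2 one_pos).trans_le (norm_nonneg _)).ne'
  · exact key (A + C) (hA.isCompactOperator.add hC') β (by rw [h, add_assoc]) hN

/-- An operator whose absolute square is a nonnegative compact perturbation of a scalar, up to a
finite-rank operator, is absolutely norming. -/
theorem isAbsolutelyNorming_of_adjoint_comp_eq {B : E →L[ℂ] F} {β : ℝ} {A C : E →L[ℂ] E}
    (hA : IsFiniteRank A) (hC : C.IsPositive) (hC' : IsCompactOperator C)
    (h : adjoint B ∘L B = (β : ℂ) • ContinuousLinearMap.id ℂ E + A + C) :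
    IsAbsolutelyNorming B := by
  intro M hM hM0
  have := hM.completeSpace_coe
  have := Submodule.nontrivial_iff_ne_bot.2 hM0
  refine isNorming_of_adjoint_comp_eq (β := β) (A := adjoint M.subtypeL ∘L A ∘L M.subtypeL)
    (C := adjoint M.subtypeL ∘L C ∘L M.subtypeL) ((hA.comp_right _).comp_left _)
    (hC.adjoint_conj _) ((hC'.comp_clm M.subtypeL).clm_comp (adjoint M.subtypeL)) ?_
  rw [adjoint_comp, comp_assoc, ← comp_assoc (adjoint B), h, add_comp, add_comp, comp_add,
    comp_add, smul_comp, comp_smul, id_comp]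
  congr 3
  ext x
  simp [Submodule.adjoint_subtypeL]

end Norming

/-! ### Necessity: an orthonormal basis of eigenvectors. -/

section Eigenbasis

variable {H : Type*} [NormedAddCommGroup H] [InnerProductSpace ℂ H] [CompleteSpace H]

/-- From `(P + c)(P - c)u = 0`, the vector `w = (P - c)u` satisfies `Pw = -cw`, which positivity
forbids for `c > 0` unless `w = 0`. -/
theorem ContinuousLinearMap.IsPositive.apply_eq_of_apply_apply_eq {P : H →L[ℂ] H}
    (hP : P.IsPositive) {c : ℝ} (hc : 0 ≤ c) {u : H} (hu : P (P u) = ((c ^ 2 : ℝ) : ℂ) • u) :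
    P u = (c : ℂ) • u := by
  set w := P u - (c : ℂ) • u with hw
  have hPw : P w = -((c : ℂ) • w) := by
    rw [hw, map_sub, map_smul, hu, smul_sub, smul_smul, ← sq]
    push_cast
    abel
  have h1 : 0 ≤ -(c * ‖w‖ ^ 2) := by
    have h := hP.re_inner_nonneg_left w
    rw [hPw, inner_neg_left, inner_smul_left, inner_self_eq_norm_sq_to_K, Complex.conj_ofReal,
      map_neg] at h
    norm_cast at h
    exact h.trans_eq (congrArg Neg.neg (Complex.re_ofReal_mul c ((‖w‖ ^ 2 : ℝ) : ℂ)))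
  rcases hc.eq_or_lt with rfl | hc
  · have h2 : ‖P u‖ ^ 2 = 0 := by
      rw [apply_norm_sq_eq_inner_adjoint_left, hP.isSelfAdjoint.adjoint_eq, comp_apply, hu]
      simp
    simpa using h2
  · have : ‖w‖ ^ 2 = 0 := by
      have : 0 ≤ ‖w‖ ^ 2 := by positivity
      nlinarith
    have : w = 0 := by simpa using this
    exact sub_eq_zero.1 this

/-- A positive absolutely norming operator has an eigenvector in each nonzero closed invariant
subspace. -/
theorem IsAbsolutelyNorming.exists_eigenvector {P : H →L[ℂ] H} (hT : IsAbsolutelyNorming P)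
    (hP : P.IsPositive) {M : Submodule ℂ H} (hM : IsClosed (M : Set H)) (hM0 : M ≠ ⊥)
    (hPM : ∀ x ∈ M, P x ∈ M) : ∃ u ∈ M, ‖u‖ = 1 ∧ ∃ c : ℝ, 0 ≤ c ∧ P u = (c : ℂ) • u := by
  obtain ⟨u, hu, hN⟩ := hT M hM hM0
  have := hM.completeSpace_coe
  refine ⟨u, u.2, hu, ‖P ∘L M.subtypeL‖, opNorm_nonneg _,
    hP.apply_eq_of_apply_apply_eq (opNorm_nonneg _) ?_⟩
  have h := adjoint_apply_apply_of_norm_eq (P ∘L M.subtypeL) le_rfl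
    (u := u) (by rw [hu, mul_one, hN])
  rw [adjoint_comp, hP.isSelfAdjoint.adjoint_eq, Submodule.adjoint_subtypeL] at h
  have h' := congrArg (Subtype.val) h
  -- Invariance of `M` makes the projection in the adjoint of the restriction act trivially, leaving
  -- `P²u = N²u` in `H`.
  have hmem : P (P (u : H)) ∈ M := hPM _ (hPM _ u.2)
  have hproj : M.orthogonalProjectionOnto (P (P (u : H))) = ⟨_, hmem⟩ :=
    M.orthogonalProjectionOnto_mem_subspace_eq_self ⟨_, hmem⟩
  simpa [hproj] using h'

/-- Zorn gives a maximal orthonormal set of eigenvectors. Its orthogonal complement is invariant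
because `P` is symmetric, so if nonzero it would contain a further eigenvector. -/
theorem IsAbsolutelyNorming.exists_eigenbasis {P : H →L[ℂ] H} (hT : IsAbsolutelyNorming P)
    (hP : P.IsPositive) : ∃ (s : Set H) (b : HilbertBasis s ℂ H) (l : s → ℝ),
      ∀ i, 0 ≤ l i ∧ P (b i) = (l i : ℂ) • b i := by
  obtain ⟨s, hs⟩ := zorn_subset {s : Set H | Orthonormal ℂ (Subtype.val : s → H) ∧
      ∀ x ∈ s, ∃ c : ℝ, 0 ≤ c ∧ P x = (c : ℂ) • x} (by
    refine fun c hc cc ↦ ⟨⋃₀ c, ⟨?_, ?_⟩, fun _ ↦ Set.subset_sUnion_of_mem⟩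
    · exact orthonormal_sUnion_of_directed cc.directedOn fun x xc ↦ (hc xc).1
    · rintro x ⟨t, ht, hxt⟩
      exact (hc ht).2 x hxt)
  have hbot : (Submodule.span ℂ (Set.range (Subtype.val : s → H)))ᗮ = ⊥ := by
    by_contra hne
    rw [Subtype.range_coe] at hne
    have hmem : ∀ y, y ∈ (Submodule.span ℂ s)ᗮ ↔ ∀ x ∈ s, inner ℂ x y = 0 := by
      intro y
      constructor
      · exact fun hy x hx ↦ (Submodule.mem_orthogonal _ _).1 hy x (Submodule.subset_span hx)
      · intro hy
        have hle : Submodule.span ℂ s ≤ (Submodule.span ℂ {y})ᗮ := Submodule.span_le.2 fun x hx ↦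
          Submodule.mem_orthogonal_singleton_iff_inner_left.2 (hy x hx)
        exact (Submodule.mem_orthogonal _ _).2 fun x hx ↦
          Submodule.mem_orthogonal_singleton_iff_inner_left.1 (hle hx)
    obtain ⟨u, huM, hu1, c, hc, hPu⟩ := hT.exists_eigenvector hP
      (Submodule.isClosed_orthogonal _) hne (by
        intro y hy
        rw [hmem] at hy ⊢
        intro x hx
        obtain ⟨c, -, hPx⟩ := hs.prop.2 x hx
        rw [← hP.inner_left_eq_inner_right, hPx, inner_smul_left, hy x hx, mul_zero])
    rw [hmem] at huM
    have hins : insert u s ⊆ s := by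
      refine hs.le_of_ge ⟨?_, ?_⟩ (Set.subset_insert u s)
      · classical
        have h0 := orthonormal_subtype_iff_ite.1 hs.prop.1
        have hus : u ∉ s := fun h ↦ by
          have := huM u h
          rw [inner_self_eq_zero] at this
          simp [this] at hu1
        rw [orthonormal_subtype_iff_ite]
        rintro v (rfl | hv) w (rfl | hw)
        · simp [inner_self_eq_norm_sq_to_K, hu1]
        · rw [if_neg (by rintro rfl; exact hus hw), inner_eq_zero_symm]
          exact huM w hw
        · rw [if_neg (by rintro rfl; exact hus hv)]
          exact huM v hv
        · exact h0 v hv w hw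
      · rintro x (rfl | hx)
        · exact ⟨c, hc, hPu⟩
        · exact hs.prop.2 x hx
    have := huM u (hins (Set.mem_insert u s))
    rw [inner_self_eq_zero] at this
    simp [this] at hu1
  choose l hl using fun i : s ↦ hs.prop.2 i i.2
  refine ⟨s, HilbertBasis.mkOfOrthogonalEqBot hs.prop.1 hbot, l, fun i ↦ ?_⟩
  rw [HilbertBasis.coe_mkOfOrthogonalEqBot]
  exact hl i

end Eigenbasis

/-! ### Suprema over orthogonal families are attained. -/

section Supremum

variable {H K : Type*} [NormedAddCommGroup H] [InnerProductSpace ℂ H] [CompleteSpace H]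
  [NormedAddCommGroup K] [InnerProductSpace ℂ K] [CompleteSpace K]

/-- On an orthonormal family with orthogonal images, an absolutely norming operator attains the
supremum of the norms of the images. -/
theorem IsAbsolutelyNorming.exists_forall_norm_le {ι : Type*} [Nonempty ι] {T : H →L[ℂ] K}
    (hT : IsAbsolutelyNorming T) {x : ι → H} (hx : Orthonormal ℂ x)
    (hTx : ∀ i j, i ≠ j → inner ℂ (T (x i)) (T (x j)) = 0) :
    ∃ i₀, ∀ i, ‖T (x i)‖ ≤ ‖T (x i₀)‖ := by
  set M := (Submodule.span ℂ (Set.range x)).topologicalClosure with hMdef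
  have hMc : IsClosed (M : Set H) := Submodule.isClosed_topologicalClosure _
  have hxM : ∀ i, x i ∈ M := fun i ↦
    Submodule.le_topologicalClosure _ (Submodule.subset_span ⟨i, rfl⟩)
  have hperp : ∀ w : H, (∀ i, inner ℂ w (x i) = 0) → ∀ y ∈ M, inner ℂ w y = 0 := by
    intro w hw y hy
    have hle : M ≤ (Submodule.span ℂ {w})ᗮ := by
      refine Submodule.topologicalClosure_minimal _ (Submodule.span_le.2 ?_)
        (Submodule.isClosed_orthogonal _)
      rintro _ ⟨i, rfl⟩
      exact Submodule.mem_orthogonal_singleton_iff_inner_right.2 (hw i)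
    exact Submodule.mem_orthogonal_singleton_iff_inner_right.1 (hle hy)
  have hM0 : M ≠ ⊥ := by
    obtain ⟨i⟩ := ‹Nonempty ι›
    exact fun h ↦ hx.ne_zero i ((Submodule.mem_bot ℂ).1 (h ▸ hxM i))
  obtain ⟨u, hu, hN⟩ := hT M hMc hM0
  have := hMc.completeSpace_coe
  set N := ‖T ∘L M.subtypeL‖ with hNdef
  have hadj := adjoint_apply_apply_of_norm_eq (T ∘L M.subtypeL) le_rfl
    (u := u) (by rw [hu, mul_one]; exact hN.symm)
  have hle : ∀ i, ‖T (x i)‖ ≤ N := fun i ↦ by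
    simpa [hx.1 i] using (T ∘L M.subtypeL).le_opNorm ⟨x i, hxM i⟩
  -- On `M`, the compression of `T†T` has `u` as eigenvector for `N²` and each `x i` for `‖T (x
  -- i)‖²`. Eigenvectors that are not orthogonal share their eigenvalue.
  obtain ⟨i₀, hi₀⟩ : ∃ i, inner ℂ (u : H) (x i) ≠ 0 := by
    by_contra! h
    have := hperp u h u u.2
    rw [inner_self_eq_zero] at this
    have : u = 0 := Subtype.ext this
    simp [this] at hu
  refine ⟨i₀, fun i ↦ (hle i).trans_eq ?_⟩
  have h1 : inner ℂ (T u) (T (x i₀)) = ((N ^ 2 : ℝ) : ℂ) * inner ℂ (u : H) (x i₀) := by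
    have := congrArg (fun v ↦ inner ℂ v (⟨x i₀, hxM i₀⟩ : M)) hadj
    simp only [adjoint_inner_left, inner_smul_left, Complex.conj_ofReal] at this
    exact this
  have h2 : inner ℂ (T (x i₀)) (T u) = ((‖T (x i₀)‖ ^ 2 : ℝ) : ℂ) * inner ℂ (x i₀) (u : H) := by
    have := hperp (adjoint T (T (x i₀)) - ((‖T (x i₀)‖ ^ 2 : ℝ) : ℂ) • x i₀) (by
      intro j
      rw [inner_sub_left, adjoint_inner_left, inner_smul_left, Complex.conj_ofReal]
      rcases eq_or_ne i₀ j with rfl | hj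
      · rw [inner_self_eq_norm_sq_to_K, inner_self_eq_norm_sq_to_K, hx.1]
        simp
      · rw [hTx _ _ hj, hx.2 hj, mul_zero, sub_zero]) u u.2
    rw [inner_sub_left, adjoint_inner_left, inner_smul_left, Complex.conj_ofReal] at this
    exact sub_eq_zero.1 this
  have h3 := congrArg (starRingEnd ℂ) h1
  rw [inner_conj_symm, h2, map_mul, inner_conj_symm, Complex.conj_ofReal] at h3
  have h4 := mul_right_cancel₀ (by rwa [Ne, inner_eq_zero_symm]) h3
  have h5 : ‖T (x i₀)‖ ^ 2 = N ^ 2 := by exact_mod_cast h4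
  exact ((sq_eq_sq₀ (norm_nonneg _) (opNorm_nonneg _)).1 h5).symm

end Supremum

/-! ### Accumulation of the eigenvalues. -/

section Spectrum

variable {H : Type*} [NormedAddCommGroup H] [InnerProductSpace ℂ H] [CompleteSpace H]

theorem Orthonormal.inner_pair {H ι : Type*} [NormedAddCommGroup H] [InnerProductSpace ℂ H]
    {b : ι → H} (hb : Orthonormal ℂ b)
    {e f : ℕ → ι} (he : Function.Injective e) (hf : Function.Injective f)
    (hef : ∀ m n, e m ≠ f n) (m n : ℕ) (c d c' d' : ℝ) :
    inner ℂ ((c : ℂ) • b (e m) + (d : ℂ) • b (f m)) ((c' : ℂ) • b (e n) + (d' : ℂ) • b (f n)) =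
      if m = n then ((c * c' + d * d' : ℝ) : ℂ) else 0 := by
  classical
  have h := orthonormal_iff_ite.1 hb
  simp only [inner_add_left, inner_add_right, inner_smul_left, inner_smul_right, h,
    he.eq_iff, hf.eq_iff, hef, (hef _ _).symm, Complex.conj_ofReal, if_false]
  split_ifs
  · push_cast
    ring
  · ring

/-- Pairing small eigenvalues with large ones, unit vectors `x n` in the span of each pair can be
tuned so that `‖P (x n)‖²` strictly increases. The images stay orthogonal, so the supremum would
have to be attained. -/
theorem IsAbsolutelyNorming.not_infinite_and_infinite {ι : Type*} {P : H →L[ℂ] H}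
    (hP : IsAbsolutelyNorming P) {b : ι → H} (hb : Orthonormal ℂ b) {l : ι → ℝ}
    (hl : ∀ i, 0 ≤ l i ∧ P (b i) = (l i : ℂ) • b i) {s t : ℝ} (hst : s < t)
    (h₁ : {i | l i ≤ s}.Infinite) (h₂ : {i | t ≤ l i}.Infinite) : False := by
  let e : ℕ → ι := fun n ↦ h₁.natEmbedding _ n
  let f : ℕ → ι := fun n ↦ h₂.natEmbedding _ n
  have he : Function.Injective e := Subtype.val_injective.comp (h₁.natEmbedding _).injective
  have hf : Function.Injective f := Subtype.val_injective.comp (h₂.natEmbedding _).injective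
  have hle : ∀ n, l (e n) ≤ s := fun n ↦ (h₁.natEmbedding _ n).2
  have hlf : ∀ n, t ≤ l (f n) := fun n ↦ (h₂.natEmbedding _ n).2
  have hef : ∀ m n, e m ≠ f n := fun m n h ↦ by
    have := hle m
    rw [h] at this
    linarith [hlf n]
  have hs : 0 ≤ s := (hl _).1.trans (hle 0)
  have hst2 : s ^ 2 < t ^ 2 := by gcongr
  -- A strictly increasing sequence of targets, from `s²` at `n = 0` towards `t²`, so always between
  -- the squares of the paired eigenvalues.
  let r : ℕ → ℝ := fun n ↦ t ^ 2 - (t ^ 2 - s ^ 2) / (n + 1)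
  have hr : StrictMono r := by
    refine strictMono_nat_of_lt_succ fun n ↦ ?_
    have : 0 < t ^ 2 - s ^ 2 := by linarith
    simp only [r]
    gcongr
    simp
  have hrs : ∀ n, s ^ 2 ≤ r n := fun n ↦ by
    have : r 0 = s ^ 2 := by simp [r]
    exact this ▸ hr.monotone n.zero_le
  have hrt : ∀ n, r n ≤ t ^ 2 := fun n ↦ by
    have : 0 ≤ (t ^ 2 - s ^ 2) / ((n : ℝ) + 1) :=
      div_nonneg (by linarith) (by positivity)
    simp only [r]
    linarith
  have hν : ∀ n, l (e n) ^ 2 ≤ s ^ 2 := fun n ↦ by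
    have := (hl (e n)).1
    have := hle n
    gcongr
  have hμ : ∀ n, t ^ 2 ≤ l (f n) ^ 2 := fun n ↦ by
    have := hlf n
    have : 0 ≤ t := hs.trans hst.le
    gcongr
  have hd : ∀ n, 0 < l (f n) ^ 2 - l (e n) ^ 2 := fun n ↦ by linarith [hν n, hμ n]
  -- `p²` and `q²` are the convex weights that express `r n` through `l (e n)²` and `l (f n)²`.
  let p : ℕ → ℝ := fun n ↦ √((l (f n) ^ 2 - r n) / (l (f n) ^ 2 - l (e n) ^ 2))
  let q : ℕ → ℝ := fun n ↦ √((r n - l (e n) ^ 2) / (l (f n) ^ 2 - l (e n) ^ 2))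
  have hp : ∀ n, p n ^ 2 = (l (f n) ^ 2 - r n) / (l (f n) ^ 2 - l (e n) ^ 2) := fun n ↦
    Real.sq_sqrt (div_nonneg (by linarith [hrt n, hμ n]) (hd n).le)
  have hq : ∀ n, q n ^ 2 = (r n - l (e n) ^ 2) / (l (f n) ^ 2 - l (e n) ^ 2) := fun n ↦
    Real.sq_sqrt (div_nonneg (by linarith [hrs n, hν n]) (hd n).le)
  have hpq : ∀ n, p n * p n + q n * q n = 1 := fun n ↦ by
    have := (hd n).ne'
    rw [← sq, ← sq, hp, hq]
    field_simp
    ring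
  have hpqr : ∀ n, (p n * l (e n)) * (p n * l (e n)) + (q n * l (f n)) * (q n * l (f n)) = r n := by
    intro n
    have := (hd n).ne'
    rw [← sq, ← sq, mul_pow, mul_pow, hp, hq]
    field_simp
    ring
  let x : ℕ → H := fun n ↦ (p n : ℂ) • b (e n) + (q n : ℂ) • b (f n)
  have hPx : ∀ n, P (x n) = ((p n * l (e n) : ℝ) : ℂ) • b (e n) +
      ((q n * l (f n) : ℝ) : ℂ) • b (f n) := fun n ↦ by
    simp only [x, map_add, map_smul, (hl _).2, smul_smul]
    push_cast
    rfl
  have hx : Orthonormal ℂ x := by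
    rw [orthonormal_iff_ite]
    intro m n
    rw [hb.inner_pair he hf hef]
    rcases eq_or_ne m n with rfl | h
    · rw [if_pos rfl, if_pos rfl, hpq, Complex.ofReal_one]
    · rw [if_neg h, if_neg h]
  have hPx2 : ∀ n, ‖P (x n)‖ ^ 2 = r n := fun n ↦ by
    have := inner_self_eq_norm_sq_to_K (𝕜 := ℂ) (P (x n))
    rw [hPx, hb.inner_pair he hf hef, if_pos rfl, hpqr, ← hPx] at this
    exact Complex.ofReal_injective (by push_cast; exact this.symm)
  obtain ⟨n, hn⟩ := hP.exists_forall_norm_le hx fun m n hmn ↦ by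
    rw [hPx, hPx, hb.inner_pair he hf hef, if_neg hmn]
  have h := hn (n + 1)
  have h' : ‖P (x (n + 1))‖ ^ 2 ≤ ‖P (x n)‖ ^ 2 := by gcongr
  rw [hPx2, hPx2] at h'
  exact absurd (hr n.lt_succ_self) (not_lt.2 h')

/-- A nonnegative family all of whose subfamilies attain their supremum, and which has at most one
accumulation value, accumulates only at some `α`, and only from above. -/
theorem exists_accumulation_from_above {ι : Type*} {l : ι → ℝ} (hl : ∀ i, 0 ≤ l i)
    (hmax : ∀ J : Set ι, J.Nonempty → ∃ i₀ ∈ J, ∀ i ∈ J, l i ≤ l i₀)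
    (hgap : ∀ s t, s < t → {i | l i ≤ s}.Infinite → {i | t ≤ l i}.Infinite → False) :
    ∃ α : ℝ, 0 ≤ α ∧ {i | l i < α}.Finite ∧ ∀ ε > 0, {i | α + ε ≤ l i}.Finite := by
  rcases finite_or_infinite ι with hfin | hinf
  · exact ⟨0, le_rfl, Set.toFinite _, fun _ _ ↦ Set.toFinite _⟩
  obtain ⟨j, -, hj⟩ := hmax Set.univ Set.univ_nonempty
  let S : Set ℝ := {a | {i | a ≤ l i}.Infinite}
  have hS0 : (0 : ℝ) ∈ S := by
    have : {i | 0 ≤ l i} = Set.univ := Set.eq_univ_of_forall hl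
    change {i | 0 ≤ l i}.Infinite
    rw [this]
    exact Set.infinite_univ
  have hSb : BddAbove S := ⟨l j, fun a ha ↦ by
    obtain ⟨i, hi⟩ := Set.Infinite.nonempty ha
    exact le_trans hi (hj i trivial)⟩
  refine ⟨sSup S, le_csSup hSb hS0, ?_, fun ε hε ↦ ?_⟩
  · rcases Set.eq_empty_or_nonempty {i | l i < sSup S} with h | h
    · rw [h]
      exact Set.finite_empty
    · obtain ⟨i₀, hi₀, hi⟩ := hmax _ h
      -- The values below `sSup S` have a maximum `l i₀`, so some `a ∈ S` leaves a gap above all of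
      -- them; infinitely many values lie above `a`.
      obtain ⟨a, haS, ha⟩ := exists_lt_of_lt_csSup ⟨0, hS0⟩ hi₀
      exact (Set.not_infinite.1 fun hinf ↦ hgap _ _ ha hinf haS).subset hi
  · by_contra h
    exact absurd (le_csSup hSb (show sSup S + ε ∈ S from h)) (by linarith)

end Spectrum

/-! ### Operators diagonal in a Hilbert basis. -/

section Diagonal

variable {H : Type*} [NormedAddCommGroup H] [InnerProductSpace ℂ H]
  {ι : Type*} (b : HilbertBasis ι ℂ H)

/-- The diagonal operator with finitely many real entries in an orthonormal basis. -/
noncomputable def finiteDiagonal (s : Finset ι) (d : ι → ℝ) : H →L[ℂ] H :=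
  ∑ i ∈ s, (d i : ℂ) • InnerProductSpace.rankOne ℂ (b i) (b i)

theorem isSelfAdjoint_finiteDiagonal [CompleteSpace H] (s : Finset ι) (d : ι → ℝ) :
    IsSelfAdjoint (finiteDiagonal b s d) := by
  refine isSelfAdjoint_sum _ fun i _ ↦ ?_
  refine IsSelfAdjoint.smul (Complex.conj_ofReal _) ?_
  exact (InnerProductSpace.isPositive_rankOne_self (b i)).isSelfAdjoint

theorem isFiniteRank_finiteDiagonal (s : Finset ι) (d : ι → ℝ) :
    IsFiniteRank (finiteDiagonal b s d) := by
  classical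
  unfold IsFiniteRank
  refine Submodule.finiteDimensional_of_le (S₂ := Submodule.span ℂ (s.image b : Set H)) ?_
  rintro _ ⟨x, rfl⟩
  simp only [finiteDiagonal, coe_coe, sum_apply, smul_apply, InnerProductSpace.rankOne_apply]
  exact Submodule.sum_mem _ fun i hi ↦ Submodule.smul_mem _ _ (Submodule.smul_mem _ _
    (Submodule.subset_span (by simpa using ⟨i, hi, rfl⟩)))

open Classical in
theorem finiteDiagonal_apply (s : Finset ι) (d : ι → ℝ) (j : ι) :
    finiteDiagonal b s d (b j) = ((if j ∈ s then d j else 0 : ℝ) : ℂ) • b j := by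
  simp only [finiteDiagonal, sum_apply, smul_apply, InnerProductSpace.rankOne_apply,
    orthonormal_iff_ite.1 b.orthonormal, ite_smul, one_smul, zero_smul, smul_ite, smul_zero,
    Finset.sum_ite_eq']
  split_ifs <;> simp

variable [CompleteSpace H] {b} {D : H →L[ℂ] H} {d : ι → ℝ}

theorem inner_basis_apply (hD : IsSelfAdjoint D) (hd : ∀ i, D (b i) = (d i : ℂ) • b i) (i : ι)
    (x : H) : inner ℂ (b i) (D x) = (d i : ℂ) * inner ℂ (b i) x := by
  rw [← hD.adjoint_eq, adjoint_inner_right, hd, inner_smul_left, Complex.conj_ofReal]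

theorem isPositive_of_diagonal (hD : IsSelfAdjoint D) (hd : ∀ i, D (b i) = (d i : ℂ) • b i)
    (hd0 : ∀ i, 0 ≤ d i) : D.IsPositive := by
  refine isPositive_def'.2 ⟨hD, fun x ↦ ?_⟩
  have h := (b.hasSum_inner_mul_inner x (D x)).mapL Complex.reCLM
  rw [reApplyInnerSelf_apply, inner_re_symm]
  refine h.nonneg fun i ↦ ?_
  rw [inner_basis_apply hD hd, mul_left_comm, ← inner_conj_symm x (b i),
    ← Complex.normSq_eq_conj_mul_self, Complex.reCLM_apply, Complex.re_ofReal_mul,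
    Complex.ofReal_re]
  exact mul_nonneg (hd0 i) (Complex.normSq_nonneg _)

theorem norm_le_of_diagonal (hD : IsSelfAdjoint D) (hd : ∀ i, D (b i) = (d i : ℂ) • b i)
    {ε : ℝ} (hε : 0 ≤ ε) (hdε : ∀ i, |d i| ≤ ε) : ‖D‖ ≤ ε := by
  refine opNorm_le_bound _ hε fun x ↦ ?_
  have hsum : ∀ y : H, HasSum (fun i ↦ ‖inner ℂ (b i) y‖ ^ 2) (‖y‖ ^ 2) := by
    intro y
    have h := (b.hasSum_inner_mul_inner y y).mapL Complex.reCLM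
    have hy : Complex.reCLM (inner ℂ y y) = ‖y‖ ^ 2 := inner_self_eq_norm_sq (𝕜 := ℂ) y
    rw [hy] at h
    refine h.congr_fun fun i ↦ ?_
    rw [← inner_conj_symm y (b i), ← Complex.normSq_eq_conj_mul_self, Complex.reCLM_apply,
      Complex.ofReal_re, Complex.normSq_eq_norm_sq]
  have h : ‖D x‖ ^ 2 ≤ ε ^ 2 * ‖x‖ ^ 2 := by
    refine hasSum_le (fun i ↦ ?_) (hsum (D x)) ((hsum x).mul_left (ε ^ 2))
    rw [inner_basis_apply hD hd, norm_mul, mul_pow, Complex.norm_real, Real.norm_eq_abs]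
    have := hdε i
    gcongr
  exact le_of_sq_le_sq (by rwa [mul_pow]) (by positivity)

end Diagonal

/-! ### Assembling the decomposition and its converse. -/

section Decomposition

variable {H : Type*} [NormedAddCommGroup H] [InnerProductSpace ℂ H] [CompleteSpace H]

theorem IsAbsolutelyNorming.exists_decomposition {P : H →L[ℂ] H} (hT : IsAbsolutelyNorming P)
    (hP : P.IsPositive) : ∃ (α : ℝ) (F C : H →L[ℂ] H), 0 ≤ α ∧ IsSelfAdjoint F ∧
      IsFiniteRank F ∧ C.IsPositive ∧ IsCompactOperator C ∧
      P = (α : ℂ) • ContinuousLinearMap.id ℂ H + F + C := by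
  classical
  obtain ⟨ι, b, l, hl⟩ := hT.exists_eigenbasis hP
  have hnorm : ∀ i, ‖P (b i)‖ = l i := fun i ↦ by
    rw [(hl i).2, norm_smul, b.orthonormal.1, Complex.norm_of_nonneg (hl i).1, mul_one]
  obtain ⟨α, hα, hlow, hhigh⟩ := exists_accumulation_from_above (fun i ↦ (hl i).1)
    (fun J hJ ↦ by
      have := hJ.to_subtype
      obtain ⟨i₀, hi₀⟩ := hT.exists_forall_norm_le
        (b.orthonormal.comp (Subtype.val : J → ι) Subtype.val_injective) fun i j hij ↦ by
          rw [Function.comp_apply, Function.comp_apply, (hl _).2, (hl _).2, inner_smul_left,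
            inner_smul_right, b.orthonormal.2 (Subtype.val_injective.ne hij), mul_zero, mul_zero]
      refine ⟨i₀, i₀.2, fun i hi ↦ ?_⟩
      have := hi₀ ⟨i, hi⟩
      rwa [Function.comp_apply, Function.comp_apply, hnorm, hnorm] at this)
    (fun s t hst ↦ hT.not_infinite_and_infinite b.orthonormal hl hst)
  let d : ι → ℝ := fun i ↦ l i - α
  let F := finiteDiagonal b hlow.toFinset d
  let C := P - (α : ℂ) • ContinuousLinearMap.id ℂ H - F
  have hF : IsSelfAdjoint F := isSelfAdjoint_finiteDiagonal b _ _
  have hC : IsSelfAdjoint C := by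
    refine (hP.isSelfAdjoint.sub ?_).sub hF
    exact IsSelfAdjoint.smul (Complex.conj_ofReal _) (IsSelfAdjoint.one _)
  -- `F` cancels exactly the negative entries of `P - α`.
  have hCb : ∀ i, C (b i) = ((max (d i) 0 : ℝ) : ℂ) • b i := fun i ↦ by
    simp only [C, F, sub_apply, smul_apply, id_apply, (hl i).2, finiteDiagonal_apply, ← sub_smul]
    congr 1
    norm_cast
    by_cases h : l i < α
    · simp [d, h, h.le]
    · simp [d, h, not_lt.1 h]
  refine ⟨α, F, C, hα, hF, isFiniteRank_finiteDiagonal b _ _,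
    isPositive_of_diagonal hC hCb fun i ↦ le_max_right _ _, ?_, by simp [C]⟩
  have hcl : IsClosed {A : H →L[ℂ] H | IsCompactOperator A} := isClosed_setOfPred_isCompactOperator
  have hmem : C ∈ closure {A : H →L[ℂ] H | IsCompactOperator A} := by
    refine Metric.mem_closure_iff.2 fun ε hε ↦ ?_
    -- Keeping only the entries at least `ε / 2` gives finite rank and leaves a diagonal remainder
    -- with entries in `[0, ε / 2]`.
    let G := finiteDiagonal b (hhigh (ε / 2) (half_pos hε)).toFinset d
    refine ⟨G, (isFiniteRank_finiteDiagonal b _ _).isCompactOperator, ?_⟩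
    rw [dist_eq_norm]
    refine lt_of_le_of_lt (norm_le_of_diagonal (b := b) (ε := ε / 2)
      (d := fun i ↦ if α + ε / 2 ≤ l i then 0 else max (d i) 0)
      (hC.sub (isSelfAdjoint_finiteDiagonal b _ _)) (fun i ↦ ?_) (half_pos hε).le fun i ↦ ?_)
      (half_lt_self hε)
    · simp only [sub_apply, hCb, finiteDiagonal_apply, ← sub_smul]
      congr 1
      norm_cast
      by_cases h : α + ε / 2 ≤ l i
      · have : 0 ≤ d i := by simp only [d]; linarith
        simp [h, this]
      · simp [h]
    · split_ifs with h
      · simpa using (half_pos hε).le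
      · rw [abs_of_nonneg (le_max_right _ _)]
        refine max_le ?_ (half_pos hε).le
        simp only [d]
        linarith
  rwa [hcl.closure_eq] at hmem

/-- Squaring gives `|T|² = α² + ((α + C)F + F|T|) + (2αC + C²)`: the middle bracket has finite rank,
and `α ≥ 0` keeps the last one positive. -/
theorem isAbsolutelyNorming_of_absOp_eq {K : Type*} [NormedAddCommGroup K]
    [InnerProductSpace ℂ K] [CompleteSpace K] {T : H →L[ℂ] K} {α : ℝ} {F C : H →L[ℂ] H}
    (hα : 0 ≤ α) (hF : IsFiniteRank F) (hC : C.IsPositive) (hC' : IsCompactOperator C)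
    (h : absOp T = (α : ℂ) • ContinuousLinearMap.id ℂ H + F + C) : IsAbsolutelyNorming T := by
  refine isAbsolutelyNorming_of_adjoint_comp_eq (β := α ^ 2)
    (A := ((α : ℂ) • ContinuousLinearMap.id ℂ H + C) ∘L F + F ∘L absOp T)
    (C := ((2 * α : ℝ) : ℂ) • C + C ∘L C) ((hF.comp_left _).add (hF.comp_right _)) ?_ ?_ ?_
  · refine (hC.smul_of_nonneg ?_).add ?_
    · exact_mod_cast mul_nonneg zero_le_two hα
    · have := isPositive_adjoint_comp_self C
      rwa [hC.isSelfAdjoint.adjoint_eq] at this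
  · exact (hC'.smul _).add (hC'.clm_comp C)
  · rw [← absOp_comp_absOp, h]
    ext x
    simp only [comp_apply, add_apply, smul_apply, id_apply, map_add, map_smul, smul_add]
    push_cast
    module

theorem isAbsolutelyNorming_absOp_iff {K : Type*} [NormedAddCommGroup K]
    [InnerProductSpace ℂ K] [CompleteSpace K] {T : H →L[ℂ] K} :
    IsAbsolutelyNorming (absOp T) ↔ IsAbsolutelyNorming T := by
  have hx : ∀ (M : Submodule ℂ H) (x : M),
      ‖(absOp T ∘L M.subtypeL) x‖ = ‖(T ∘L M.subtypeL) x‖ := fun M x ↦ norm_absOp_apply T x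
  have hn : ∀ M : Submodule ℂ H, ‖absOp T ∘L M.subtypeL‖ = ‖T ∘L M.subtypeL‖ := fun M ↦
    le_antisymm (opNorm_le_bound _ (opNorm_nonneg _) fun x ↦ hx M x ▸ le_opNorm _ x)
      (opNorm_le_bound _ (opNorm_nonneg _) fun x ↦ hx M x ▸ le_opNorm _ x)
  simp only [IsAbsolutelyNorming, IsNorming, hx, hn]

end Decomposition

theorem theorem6p3 {H K : Type*}
    [NormedAddCommGroup H] [InnerProductSpace ℂ H] [CompleteSpace H]
    [NormedAddCommGroup K] [InnerProductSpace ℂ K] [CompleteSpace K]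
    (T : H →L[ℂ] K) :
    (∃! U : H →L[ℂ] K, IsPolarFactor T U) ∧
    ∀ U : H →L[ℂ] K, IsPolarFactor T U →
      ContinuousLinearMap.adjoint U ∘L T = absOp T ∧
      (IsAbsolutelyNorming T ↔
        ∃ (α : ℝ) (F C : H →L[ℂ] H), 0 ≤ α ∧
          IsSelfAdjoint F ∧ IsFiniteRank F ∧
          C.IsPositive ∧ IsCompactOperator C ∧
          ContinuousLinearMap.adjoint U ∘L T =
            (α : ℂ) • ContinuousLinearMap.id ℂ H + F + C) := by
  obtain ⟨V, hV⟩ := exists_isPolarFactor T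
  refine ⟨⟨V, hV, fun U hU ↦ hU.unique hV⟩, fun U hU ↦ ⟨hU.adjoint_comp, ?_⟩⟩
  rw [hU.adjoint_comp]
  constructor
  · exact fun hT ↦ (isAbsolutelyNorming_absOp_iff.2 hT).exists_decomposition (absOp_isPositive T)
  · rintro ⟨α, F, C, hα, -, hF, hC, hC', h⟩
    exact isAbsolutelyNorming_of_absOp_eq hα hF hC hC' h
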